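/- Let $K$ be a field of characteristic different from $2$, let $\alpha \in K$ be non-zero, let $E$ be a finite-dimensional vector space over $K$, and let $u$ be an endomorphism of $E$. Call $u$ an $(\alpha,\alpha)$-composite if there are two idempotents $p, q \in \mathrm{End}(E)$ (that is, $p^2=p$ and $q^2=q$) such that $u = \alpha p + \alpha q$. For $\lambda \in K$ and an integer $k \ge 1$, set $$n_k(u,\lambda) := \dim \ker (u-\lambda\,\mathrm{id}_E)^k - \dim \ker (u-\lambda\,\mathrm{id}_E)^{k-1}.$$ Two sequences of integers $(a_k)_{k\ge 1}$ and $(b_k)_{k \ge 1}$ are called intertwined if $b_{k+1} \le a_k$ and $a_{k+1} \le b_k$ for all $k \ge 1$. Write the minimal polynomial of $u$ as $\mu_u = P\,Q$, where $P$ is monic and splits over $K$ with all its roots in $\{0,\alpha,2\alpha\}$, and $Q$ is monic with no root in $\{0,\alpha,2\alpha\}$; let $u_{-\{0,\alpha,2\alpha\}}$ denote the endomorphism of $\ker Q(u)$ induced by $u$. The elementary factors (invariant factors) of an endomorphism $v$ of a finite-dimensional $K$-vector space $F$ are the non-constant monic polynomials $P_1 \mid P_2 \mid \dots \mid P_N$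 in $K[X]$ such that $F$, regarded as a $K[X]$-module on which $X$ acts as $v$, is isomorphic to $\bigoplus_{i=1}^N K[X]/(P_i)$. Then $u$ is an $(\alpha,\alpha)$-composite if and only if both of the following conditions hold: (i) the sequences $(n_k(u,0))_{k\ge 1}$ and $(n_k(u,2\alpha))_{k\ge 1}$ are intertwined; (ii) every elementary factor of $u_{-\{0,\alpha,2\alpha\}}$ is a polynomial in $(X-\alpha)^2$, i.e. of the form $R\bigl((X-\alpha)^2\bigr)$ with $R \in K[X]$. -/

import Mathlib

open Polynomial

/-- An element `x` of a `K`-algebra is an `(α, β)`-composite when `x = α p + β q` for two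
idempotents `p` and `q` of that algebra. -/
def IsComposite {K A : Type*} [Field K] [Ring A] [Algebra K A] (α β : K) (x : A) : Prop :=
  ∃ p q : A, IsIdempotentElem p ∧ IsIdempotentElem q ∧ x = α • p + β • q

section Endomorphisms

variable {K E : Type*} [Field K] [AddCommGroup E] [Module K E]

/-- `jordanCount u lam k = dim Ker (u - lam)^k - dim Ker (u - lam)^(k-1)` for `k ≥ 1`: the number of
Jordan blocks of `u` of size at least `k` for the eigenvalue `lam`. Only used for `k ≥ 1`. -/
noncomputable def jordanCount (u : Module.End K E) (lam : K) (k : ℕ) : ℤ :=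
  (Module.finrank K (LinearMap.ker ((u - algebraMap K (Module.End K E) lam) ^ k)) : ℤ) -
    (Module.finrank K (LinearMap.ker ((u - algebraMap K (Module.End K E) lam) ^ (k - 1))) : ℤ)

/-- Two sequences indexed by the positive integers are intertwined when
`v_{k+1} ≤ u_k` and `u_{k+1} ≤ v_k` for all `k ≥ 1`. -/
def Intertwined (u v : ℕ → ℤ) : Prop :=
  ∀ k : ℕ, 1 ≤ k → v (k + 1) ≤ u k ∧ u (k + 1) ≤ v k

open Classical in
/-- The monic divisor of `p` that collects all roots of `p` lying in `S`, with multiplicity. -/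
noncomputable def rootsPart (S : Set K) (p : K[X]) : K[X] :=
  ((p.roots.filter (fun a => a ∈ S)).map (fun a => X - C a)).prod

/-- The cofactor `Q` in `p = P * Q`, where `P` is monic with all its roots in `S` and split, and
`Q` has no root in `S` (for `p ≠ 0`). -/
noncomputable def rootFreePart (S : Set K) (p : K[X]) : K[X] :=
  p /ₘ rootsPart S p

/-- The kernel of a polynomial in `u` is stable under `u`. -/
theorem mem_ker_aeval_of_mem (u : Module.End K E) (p : K[X]) :
    ∀ x ∈ LinearMap.ker (aeval u p), u x ∈ LinearMap.ker (aeval u p) := by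
  intro x hx
  have h : aeval u p * u = u * aeval u p := by
    simpa using congrArg (aeval u) (mul_comm p X)
  rw [LinearMap.mem_ker] at hx ⊢
  have h2 := LinearMap.congr_fun h x
  simp only [Module.End.mul_apply, hx, map_zero] at h2
  exact h2

/-- With `μ_u = P * Q` the minimal polynomial of `u`, where `P` is monic and split with all its
roots in `S` and `Q` is monic with no root in `S`, this is the subspace `Ker Q(u)`. -/
noncomputable def awaySubspace (S : Set K) (u : Module.End K E) : Submodule K E :=
  LinearMap.ker (aeval u (rootFreePart S (minpoly K u)))

/-- The endomorphism `u_{-S}` of `Ker Q(u)` induced by `u`. -/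
noncomputable def awayPart (S : Set K) (u : Module.End K E) :
    Module.End K (awaySubspace S u) :=
  u.restrict (mem_ker_aeval_of_mem u (rootFreePart S (minpoly K u)))

/-- `P_0 ∣ P_1 ∣ ⋯ ∣ P_{N-1}` is the list of elementary factors (invariant factors) of `u`: the
`P_i` are monic and nonconstant, each divides the next ones, and the `K[X]`-module `E` on which
`X` acts as `u` is isomorphic to the direct sum of the `K[X] / (P_i)`, i.e. `u` is represented
by the block-diagonal matrix of the companion matrices of the `P_i`. -/
def IsElementaryFactors (u : Module.End K E) {N : ℕ} (P : Fin N → K[X]) : Prop :=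
  (∀ i, (P i).Monic ∧ 0 < (P i).natDegree) ∧
  (∀ i j, i ≤ j → P i ∣ P j) ∧
  Nonempty (Module.AEval' u ≃ₗ[K[X]] ((i : Fin N) → K[X] ⧸ Ideal.span {P i}))

end Endomorphisms

/-!
Put `c = 2 * α`. As `2` is invertible, `u` is an `(α, α)`-composite if and only if some `D`
satisfies `D u = (c - u) D` and `D² = u (c - u)`.

Such a `D` exchanges `ker u ^ n` and `ker (c - u) ^ n`, and on each of them `ker D ^ (2 * k)` cuts
out `ker u ^ k` and `ker (c - u) ^ k` respectively; comparing the dimensions of the kernels of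
successive powers of `D` makes the Jordan counts at `0` and `c` intertwined. Where `u` and `c - u`
are invertible, `u⁻¹ D` is an involution that conjugates `z = u - α` to `-z`. If `z` is invertible
too, the space is `F ⊕ z F` with `F` the fixed space of the involution, so the `K[X]`-module is
obtained from `F`, with `X` acting as `z²`, by extension of scalars along `X ↦ (X - α)²`, and its
elementary factors are those of `F` evaluated at `(X - α)²`.

Conversely, `D` amounts to a map that is semilinear over `X ↦ c - X` and squares to `X (c - X)`.
On a cyclic module `K[X] / (P)` it can be taken to be `f(X) ↦ g f(c - X)` with `g = X` or
`g = c - X`: for `P` a polynomial in `(X - α)²` because `P` is invariant under `X ↦ c - X`, and for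
the factors with roots in `{0, α, c}` because intertwining forces the multiplicities of `0` and `c`
in each elementary factor to differ by at most one.
-/
section PrincipalIdealDomain

variable {R : Type*} [CommRing R]

theorem nonempty_equiv_of_ker_eq {M N N' : Type*} [AddCommGroup M] [Module R M]
    [AddCommGroup N] [Module R N] [AddCommGroup N'] [Module R N'] {f : M →ₗ[R] N} {g : M →ₗ[R] N'}
    (hf : Function.Surjective f) (hg : Function.Surjective g)
    (h : LinearMap.ker f = LinearMap.ker g) : Nonempty (N ≃ₗ[R] N') :=
  ⟨(f.quotKerEquivOfSurjective hf).symm ≪≫ₗ Submodule.quotEquivOfEq _ _ h ≪≫ₗ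
    g.quotKerEquivOfSurjective hg⟩

theorem nonempty_quotient_prod_equiv {g a b : R} (hab : IsCoprime a b) :
    Nonempty (((R ⧸ Ideal.span {g * a}) × (R ⧸ Ideal.span {g * b})) ≃ₗ[R]
      ((R ⧸ Ideal.span {g}) × (R ⧸ Ideal.span {g * a * b}))) := by
  obtain ⟨x, y, h⟩ := hab
  -- The unimodular change of basis of `R × R` with rows `(x, -y)` and `(b, a)`.
  let φ : R × R →ₗ[R] R × R :=
    LinearMap.prod (x • LinearMap.fst R R R - y • LinearMap.snd R R R)
      (b • LinearMap.fst R R R + a • LinearMap.snd R R R)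
  have hφ : Function.Surjective φ := fun ⟨s, t⟩ =>
    ⟨(a * s + y * t, x * t - b * s), Prod.ext
      (show x * (a * s + y * t) - y * (x * t - b * s) = s by linear_combination s * h)
      (show b * (a * s + y * t) + a * (x * t - b * s) = t by linear_combination t * h)⟩
  refine nonempty_equiv_of_ker_eq
    (f := (Ideal.span {g * a}).mkQ.prodMap (Ideal.span {g * b}).mkQ)
    (g := ((Ideal.span {g}).mkQ.prodMap (Ideal.span {g * a * b}).mkQ) ∘ₗ φ)
    ((Submodule.mkQ_surjective _).prodMap (Submodule.mkQ_surjective _))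
    (((Submodule.mkQ_surjective _).prodMap (Submodule.mkQ_surjective _)).comp hφ) ?_
  ext ⟨s, t⟩
  simp only [LinearMap.mem_ker, LinearMap.prodMap_apply, Submodule.mkQ_apply,
    LinearMap.comp_apply, Prod.mk_eq_zero, Submodule.Quotient.mk_eq_zero,
    Ideal.mem_span_singleton, φ, LinearMap.prod_apply, Function.prod_apply, LinearMap.sub_apply,
    LinearMap.add_apply, LinearMap.smul_apply, LinearMap.fst_apply, LinearMap.snd_apply,
    smul_eq_mul]
  constructor
  · rintro ⟨⟨s', rfl⟩, t', rfl⟩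
    exact ⟨⟨x * a * s' - y * b * t', by ring⟩, s' + t', by ring⟩
  · rintro ⟨⟨p, hp⟩, q, hq⟩
    exact ⟨⟨p + y * b * q, by linear_combination a * hp + y * hq - s * h⟩,
      x * a * q - p, by linear_combination x * hq - b * hp - t * h⟩

theorem exists_dvd_chain_not_isUnit {n : ℕ} (P : Fin n → R) (hP : ∀ i j, i ≤ j → P i ∣ P j) :
    ∃ (m : ℕ) (P' : Fin m → R), (∀ i, ¬ IsUnit (P' i)) ∧ (∀ i j, i ≤ j → P' i ∣ P' j) ∧
      Nonempty (((i : Fin n) → R ⧸ Ideal.span {P i}) ≃ₗ[R]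
        ((i : Fin m) → R ⧸ Ideal.span {P' i})) := by
  induction n with
  | zero => exact ⟨0, P, fun i => i.elim0, hP, ⟨.refl R _⟩⟩
  | succ n ih =>
    by_cases hu : IsUnit (P 0)
    · obtain ⟨m, P', hunit, hP', ⟨e⟩⟩ := ih (fun i => P i.succ)
        fun i j hij => hP _ _ (Fin.succ_le_succ_iff.2 hij)
      have : Subsingleton (R ⧸ Ideal.span {P 0}) :=
        Ideal.Quotient.subsingleton_iff.2 (Ideal.span_singleton_eq_top.2 hu)
      let := uniqueOfSubsingleton (0 : R ⧸ Ideal.span {P 0})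
      exact ⟨m, P', hunit, hP', ⟨(Fin.consLinearEquiv R fun i => R ⧸ Ideal.span {P i}).symm ≪≫ₗ
        LinearEquiv.uniqueProd ≪≫ₗ e⟩⟩
    · exact ⟨n + 1, P, fun i hi => hu (isUnit_of_dvd_unit (hP 0 i (Fin.zero_le i)) hi), hP,
        ⟨.refl R _⟩⟩

variable [IsDomain R] [IsPrincipalIdealRing R]

theorem exists_gcd_mul_isCoprime (a b : R) :
    ∃ g a' b' : R, a = g * a' ∧ b = g * b' ∧ IsCoprime a' b' := by
  classical
  let := IsBezout.toGCDDomain R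
  obtain ⟨a', b', ha, hb, hunit⟩ := extract_gcd a b
  exact ⟨_, a', b', ha, hb, (gcd_isUnit_iff a' b').1 hunit⟩

theorem exists_dvd_chain_cons {n : ℕ} (a : R) (P : Fin n → R) (hP : ∀ i j, i ≤ j → P i ∣ P j) :
    ∃ P' : Fin (n + 1) → R, (∀ i j, i ≤ j → P' i ∣ P' j) ∧
      (∀ c, c ∣ a → (∀ i, c ∣ P i) → ∀ i, c ∣ P' i) ∧
      Nonempty (((R ⧸ Ideal.span {a}) × ((i : Fin n) → R ⧸ Ideal.span {P i})) ≃ₗ[R]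
        ((i : Fin (n + 1)) → R ⧸ Ideal.span {P' i})) := by
  let cons {m : ℕ} (b : R) (Q : Fin m → R) :=
    Fin.consLinearEquiv R fun i => R ⧸ Ideal.span {(Fin.cons b Q : Fin (m + 1) → R) i}
  induction P using Fin.consInduction generalizing a with
  | elim0 =>
    refine ⟨Fin.cons a Fin.elim0, fun i j _ => ?_, fun c hc _ i => ?_, ⟨cons a Fin.elim0⟩⟩
    · rw [Subsingleton.elim (α := Fin 1) i j]
    · rwa [Subsingleton.elim (α := Fin 1) i 0]
  | @cons n b P ih =>
    obtain ⟨g, a', b', rfl, rfl, hab⟩ := exists_gcd_mul_isCoprime a b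
    obtain ⟨e⟩ := nonempty_quotient_prod_equiv (g := g) hab
    obtain ⟨P', hP', hdvd, ⟨f⟩⟩ := ih (g * a' * b') fun i j hij => by
      simpa using hP i.succ j.succ (Fin.succ_le_succ_iff.2 hij)
    have hgP : ∀ i, g ∣ P i := fun i => by
      simpa using (dvd_mul_right g b').trans (hP 0 i.succ (Fin.zero_le _))
    have hgP' : ∀ i, g ∣ P' i := hdvd g (by simp [mul_assoc]) hgP
    refine ⟨Fin.cons g P', fun i j hij => ?_, fun c hca hcP i => ?_, ⟨?_⟩⟩
    · induction i using Fin.cases with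
      | zero => induction j using Fin.cases <;> simp [hgP']
      | succ i =>
        induction j using Fin.cases with
        | zero => simp at hij
        | succ j => simpa using hP' i j (Fin.succ_le_succ_iff.1 hij)
    · have hcg : c ∣ g := by
        obtain ⟨x, y, h⟩ := hab
        have hg : g = x * (g * a') + y * (g * b') := by linear_combination (-g) * h
        exact hg ▸ dvd_add (hca.mul_left x) ((hcP 0).mul_left y)
      induction i using Fin.cases with
      | zero => exact hcg
      | succ i => simpa using hcg.trans (hgP' i)
    · exact LinearEquiv.prodCongr (.refl R _) (cons (g * b') P).symm ≪≫ₗ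
        (LinearEquiv.prodAssoc R _ _ _).symm ≪≫ₗ LinearEquiv.prodCongr e (.refl R _) ≪≫ₗ
        LinearEquiv.prodAssoc R _ _ _ ≪≫ₗ LinearEquiv.prodCongr (.refl R _) f ≪≫ₗ cons g P'

theorem exists_dvd_chain_of_pi {n : ℕ} (a : Fin n → R) :
    ∃ P : Fin n → R, (∀ i j, i ≤ j → P i ∣ P j) ∧
      Nonempty (((i : Fin n) → R ⧸ Ideal.span {a i}) ≃ₗ[R]
        ((i : Fin n) → R ⧸ Ideal.span {P i})) := by
  induction n with
  | zero => exact ⟨a, fun i => i.elim0, ⟨.refl R _⟩⟩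
  | succ n ih =>
    obtain ⟨P, hP, ⟨e⟩⟩ := ih fun i => a i.succ
    obtain ⟨P', hP', -, ⟨f⟩⟩ := exists_dvd_chain_cons (a 0) P hP
    exact ⟨P', hP', ⟨(Fin.consLinearEquiv R fun i => R ⧸ Ideal.span {a i}).symm ≪≫ₗ
      LinearEquiv.prodCongr (.refl R _) e ≪≫ₗ f⟩⟩

theorem exists_invariant_factors {M : Type*} [AddCommGroup M] [Module R M]
    [Module.Finite R M] (hM : Module.IsTorsion R M) :
    ∃ (n : ℕ) (P : Fin n → R), (∀ i, ¬ IsUnit (P i)) ∧ (∀ i j, i ≤ j → P i ∣ P j) ∧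
      Nonempty (M ≃ₗ[R] ((i : Fin n) → R ⧸ Ideal.span {P i})) := by
  classical
  obtain ⟨ι, _, p, -, e, ⟨f⟩⟩ := Module.equiv_directSum_of_isTorsion hM
  let s := Fintype.equivFin ι
  obtain ⟨P, hP, ⟨g⟩⟩ := exists_dvd_chain_of_pi fun i => p (s.symm i) ^ e (s.symm i)
  obtain ⟨n, P', hunit, hP', ⟨h⟩⟩ := exists_dvd_chain_not_isUnit P hP
  exact ⟨n, P', hunit, hP', ⟨f ≪≫ₗ DirectSum.linearEquivFunOnFintype R ι _ ≪≫ₗ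
    (LinearEquiv.piCongrLeft R (fun i => R ⧸ Ideal.span {p i ^ e i}) s.symm).symm ≪≫ₗ g ≪≫ₗ h⟩⟩

end PrincipalIdealDomain

section Torsion

variable {R : Type*} [CommRing R] {M N : Type*} [AddCommGroup M] [Module R M]
  [AddCommGroup N] [Module R N]

theorem nonempty_torsionBy_equiv_of_equiv (e : M ≃ₗ[R] N) (a : R) :
    Nonempty (Submodule.torsionBy R M a ≃ₗ[R] Submodule.torsionBy R N a) := by
  refine ⟨e.submoduleMap _ ≪≫ₗ LinearEquiv.ofEq _ _ ?_⟩
  ext x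
  simp only [Submodule.mem_map_equiv, Submodule.mem_torsionBy_iff, ← map_smul,
    LinearEquiv.map_eq_zero_iff]

theorem nonempty_torsionBy_pi_equiv {ι : Type*} (M : ι → Type*) [∀ i, AddCommGroup (M i)]
    [∀ i, Module R (M i)] (a : R) :
    Nonempty (Submodule.torsionBy R ((i : ι) → M i) a ≃ₗ[R]
      ((i : ι) → Submodule.torsionBy R (M i) a)) :=
  ⟨{  toFun := fun x i => ⟨x.1 i, congrFun x.2 i⟩
      map_add' := fun _ _ => rfl
      map_smul' := fun _ _ => rfl
      invFun := fun x => ⟨fun i => (x i).1, funext fun i => (x i).2⟩ }⟩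

theorem nonempty_torsionBy_mul_equiv {f g : R} (hfg : IsCoprime f g) :
    Nonempty (Submodule.torsionBy R M (f * g) ≃ₗ[R]
      (Submodule.torsionBy R M f × Submodule.torsionBy R M g)) := by
  obtain ⟨a, b, hab⟩ := hfg
  have hle : Submodule.torsionBy R M f ≤ Submodule.torsionBy R M (f * g) :=
    Submodule.torsionBy_le_torsionBy_of_dvd _ _ (dvd_mul_right _ _)
  have hle' : Submodule.torsionBy R M g ≤ Submodule.torsionBy R M (f * g) :=
    Submodule.torsionBy_le_torsionBy_of_dvd _ _ (dvd_mul_left _ _)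
  refine ⟨(LinearEquiv.ofBijective
    ((Submodule.inclusion hle).coprod (Submodule.inclusion hle')) ⟨?_, ?_⟩).symm⟩
  · rw [← LinearMap.ker_eq_bot, LinearMap.ker_eq_bot']
    rintro ⟨⟨x, hx⟩, ⟨y, hy⟩⟩ h
    rw [Submodule.mem_torsionBy_iff] at hx hy
    have hyx : y = -x := eq_neg_of_add_eq_zero_right (congrArg Subtype.val h)
    have hgx : g • x = 0 := by simpa [hyx] using hy
    have hx0 : x = 0 := by
      rw [← one_smul R x, ← hab, add_smul, mul_smul, mul_smul, hx, hgx, smul_zero, smul_zero,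
        add_zero]
    simp [hyx, hx0]
  · rintro ⟨x, hx⟩
    rw [Submodule.mem_torsionBy_iff] at hx
    refine ⟨(⟨(b * g) • x, ?_⟩, ⟨(a * f) • x, ?_⟩), Subtype.ext ?_⟩
    · rw [Submodule.mem_torsionBy_iff, smul_smul, show f * (b * g) = b * (f * g) by ring,
        mul_smul, hx, smul_zero]
    · rw [Submodule.mem_torsionBy_iff, smul_smul, show g * (a * f) = a * (f * g) by ring,
        mul_smul, hx, smul_zero]
    · change (b * g) • x + (a * f) • x = x
      rw [← add_smul, add_comm, hab, one_smul]

theorem dvd_of_isTorsionBy_of_equiv {n : ℕ} {a : R} {P : Fin n → R}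
    (e : M ≃ₗ[R] ((i : Fin n) → R ⧸ Ideal.span {P i})) (ha : Module.IsTorsionBy R M a)
    (i : Fin n) : P i ∣ a := by
  have h : a • e.symm (Pi.single i 1) = 0 := @ha _
  rw [← map_smul, LinearEquiv.map_eq_zero_iff] at h
  have hi := congrFun h i
  rw [Pi.smul_apply, Pi.single_eq_same, Pi.zero_apply, Algebra.smul_def, mul_one] at hi
  exact Ideal.mem_span_singleton.1 (Ideal.Quotient.eq_zero_iff_mem.1 hi)

variable [IsDomain R]

theorem nonempty_torsionBy_quotient_equiv {f g h : R} (hfh : IsCoprime f h) (hgh : g * h ≠ 0) :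
    Nonempty (Submodule.torsionBy R (R ⧸ Ideal.span {g * h}) (g * f) ≃ₗ[R]
      (R ⧸ Ideal.span {g})) := by
  let φ : R →ₗ[R] R ⧸ Ideal.span {g * h} := (Ideal.span {g * h}).mkQ ∘ₗ LinearMap.mulLeft R h
  have hφ : ∀ m, φ m = Submodule.Quotient.mk (h * m) := fun _ => rfl
  have hker : LinearMap.ker φ = Ideal.span {g} := by
    ext m
    rw [LinearMap.mem_ker, hφ, Submodule.Quotient.mk_eq_zero, Ideal.mem_span_singleton,
      Ideal.mem_span_singleton, mul_comm g h, mul_dvd_mul_iff_left (right_ne_zero_of_mul hgh)]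
  have hrange : LinearMap.range φ = Submodule.torsionBy R _ (g * f) := by
    ext x
    obtain ⟨m, rfl⟩ := Submodule.Quotient.mk_surjective _ x
    rw [Submodule.mem_torsionBy_iff, ← Submodule.Quotient.mk_smul, smul_eq_mul,
      Submodule.Quotient.mk_eq_zero, Ideal.mem_span_singleton, mul_assoc,
      mul_dvd_mul_iff_left (left_ne_zero_of_mul hgh), LinearMap.mem_range]
    constructor
    · rintro ⟨y, hy⟩
      rw [hφ, Submodule.Quotient.eq, Ideal.mem_span_singleton] at hy
      exact ((dvd_sub_right (dvd_mul_right h y)).1 ((dvd_mul_left h g).trans hy)).mul_left f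
    · intro hm
      obtain ⟨y, rfl⟩ := hfh.symm.dvd_of_dvd_mul_left hm
      exact ⟨y, hφ y⟩
  exact ⟨(Submodule.quotEquivOfEq _ _ hker).symm ≪≫ₗ φ.quotKerEquivRange ≪≫ₗ
    LinearEquiv.ofEq _ _ hrange |>.symm⟩

theorem nonempty_torsionBy_equiv_pi_quotient {ι : Type*} {P g h : ι → R}
    (e : M ≃ₗ[R] ((i : ι) → R ⧸ Ideal.span {P i})) {a : R} (hP : ∀ i, P i = g i * h i)
    (hP0 : ∀ i, P i ≠ 0) (ha : ∀ i, ∃ f, a = g i * f ∧ IsCoprime f (h i)) :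
    Nonempty (Submodule.torsionBy R M a ≃ₗ[R] ((i : ι) → R ⧸ Ideal.span {g i})) := by
  obtain ⟨e₁⟩ := nonempty_torsionBy_equiv_of_equiv e a
  obtain ⟨e₂⟩ := nonempty_torsionBy_pi_equiv (fun i => R ⧸ Ideal.span {P i}) a
  have e₃ : ∀ i, Nonempty (Submodule.torsionBy R (R ⧸ Ideal.span {P i}) a ≃ₗ[R]
      (R ⧸ Ideal.span {g i})) := fun i => by
    obtain ⟨f, rfl, hf⟩ := ha i
    rw [hP i]
    exact nonempty_torsionBy_quotient_equiv hf (hP i ▸ hP0 i)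
  exact ⟨e₁ ≪≫ₗ e₂ ≪≫ₗ LinearEquiv.piCongrRight fun i => (e₃ i).some⟩

end Torsion

section PolynomialModule

variable {K E : Type*} [Field K] [AddCommGroup E] [Module K E]

theorem smul_aeval'_of_eq_zero_iff (u : Module.End K E) (f : K[X]) (x : E) :
    f • Module.AEval'.of u x = 0 ↔ x ∈ LinearMap.ker (aeval u f) := by
  rw [← Module.AEval.of_aeval_smul, LinearEquiv.map_eq_zero_iff]
  rfl

theorem isTorsionBy_aeval'_of_minpoly_dvd {u : Module.End K E} {f : K[X]} (h : minpoly K u ∣ f) :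
    Module.IsTorsionBy K[X] (Module.AEval' u) f := fun {x} => by
  rw [← (Module.AEval'.of u).apply_symm_apply x, smul_aeval'_of_eq_zero_iff,
    (minpoly.dvd_iff.1 h), LinearMap.ker_zero]
  trivial

theorem nonempty_aeval'_restrict_equiv (u : Module.End K E) (f : K[X]) :
    Nonempty (Module.AEval' (u.restrict (mem_ker_aeval_of_mem u f)) ≃ₗ[K[X]]
      Submodule.torsionBy K[X] (Module.AEval' u) f) := by
  let φ : LinearMap.ker (aeval u f) →ₗ[K] Submodule.torsionBy K[X] (Module.AEval' u) f :=
    { toFun := fun x => ⟨Module.AEval'.of u x, (smul_aeval'_of_eq_zero_iff u f x).2 x.2⟩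
      map_add' := fun _ _ => rfl
      map_smul' := fun _ _ => rfl }
  have hφ : Function.Bijective φ :=
    ⟨fun x y hxy => Subtype.ext ((Module.AEval'.of u).injective (congrArg Subtype.val hxy)),
      fun y => ⟨⟨(Module.AEval'.of u).symm y, (smul_aeval'_of_eq_zero_iff u f _).1 y.2⟩, rfl⟩⟩
  exact ⟨LinearEquiv.ofAEval _ (LinearEquiv.ofBijective φ hφ) fun x =>
    Subtype.ext (Module.AEval'.X_smul_of u x).symm⟩

theorem exists_elementaryFactors [FiniteDimensional K E] (u : Module.End K E) :
    ∃ (n : ℕ) (P : Fin n → K[X]), IsElementaryFactors u P := by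
  classical
  have hμ : minpoly K u ≠ 0 := minpoly.ne_zero (Algebra.IsIntegral.isIntegral u)
  have hT : Module.IsTorsionBy K[X] (Module.AEval' u) (minpoly K u) :=
    isTorsionBy_aeval'_of_minpoly_dvd dvd_rfl
  obtain ⟨n, P, hunit, hdvd, ⟨e⟩⟩ := exists_invariant_factors (R := K[X]) (M := Module.AEval' u)
    fun {x} => ⟨⟨minpoly K u, mem_nonZeroDivisors_of_ne_zero hμ⟩, @hT x⟩
  have hP0 : ∀ i, P i ≠ 0 := fun i => ne_zero_of_dvd_ne_zero hμ (dvd_of_isTorsionBy_of_equiv e hT i)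
  refine ⟨n, fun i => normalize (P i), fun i => ⟨monic_normalize (hP0 i), ?_⟩,
    fun i j hij => normalize_dvd_iff.2 (dvd_normalize_iff.2 (hdvd i j hij)),
    ⟨e ≪≫ₗ LinearEquiv.piCongrRight fun i => Submodule.quotEquivOfEq _ _
      (Ideal.span_singleton_eq_span_singleton.2 (associated_normalize (P i)))⟩⟩
  rw [natDegree_pos_iff_degree_pos, degree_normalize]
  exact degree_pos_of_ne_zero_of_nonunit (hP0 i) (hunit i)

end PolynomialModule

section JordanCount

variable {K E : Type*} [Field K] [AddCommGroup E] [Module K E]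

theorem exists_isCoprime_pow_min_rootMultiplicity {p : K[X]} (hp : p ≠ 0) (s : K) (k : ℕ) :
    ∃ f h : K[X], (X - C s) ^ k = (X - C s) ^ min k (p.rootMultiplicity s) * f ∧
      p = (X - C s) ^ min k (p.rootMultiplicity s) * h ∧ IsCoprime f h := by
  obtain ⟨q, hpq, hq⟩ := exists_eq_pow_rootMultiplicity_mul_and_not_dvd p hp s
  rcases le_total k (p.rootMultiplicity s) with hk | hk
  · refine ⟨1, (X - C s) ^ (p.rootMultiplicity s - k) * q, ?_, ?_, isCoprime_one_left⟩
    · rw [min_eq_left hk, mul_one]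
    · rwa [min_eq_left hk, ← mul_assoc, ← pow_add, Nat.add_sub_cancel' hk]
  · refine ⟨(X - C s) ^ (k - p.rootMultiplicity s), q, ?_, ?_,
      (((irreducible_X_sub_C s).coprime_iff_not_dvd).2 hq).pow_left⟩
    · rw [min_eq_right hk, ← pow_add, Nat.add_sub_cancel' hk]
    · rwa [min_eq_right hk]

namespace IsElementaryFactors

variable {u : Module.End K E} {n : ℕ} {P : Fin n → K[X]}

theorem finrank_ker_pow (hP : IsElementaryFactors u P) (s : K) (k : ℕ) :
    Module.finrank K (LinearMap.ker ((u - algebraMap K (Module.End K E) s) ^ k)) =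
      ∑ i, min k ((P i).rootMultiplicity s) := by
  obtain ⟨hmonic, -, ⟨e⟩⟩ := hP
  have hP0 : ∀ i, P i ≠ 0 := fun i => (hmonic i).1.ne_zero
  choose f h hf hh hfh using fun i => exists_isCoprime_pow_min_rootMultiplicity (hP0 i) s k
  obtain ⟨e₁⟩ := nonempty_torsionBy_equiv_pi_quotient e hh hP0 fun i => ⟨f i, hf i, hfh i⟩
  obtain ⟨e₂⟩ := nonempty_aeval'_restrict_equiv u ((X - C s) ^ k)
  have haeval : aeval u ((X - C s) ^ k) = (u - algebraMap K (Module.End K E) s) ^ k := by simp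
  have : ∀ i, Module.Finite K (K[X] ⧸ Ideal.span {(X - C s) ^ min k ((P i).rootMultiplicity s)}) :=
    fun i => (AdjoinRoot.powerBasis (pow_ne_zero _ (X_sub_C_ne_zero s))).finite
  rw [← haeval, ((Module.AEval'.of _) ≪≫ₗ (e₂ ≪≫ₗ e₁).restrictScalars K).finrank_eq,
    Module.finrank_pi_fintype]
  simp only [finrank_quotient_span_eq_natDegree, natDegree_pow, natDegree_X_sub_C, mul_one]

theorem jordanCount_eq_card (hP : IsElementaryFactors u P) (s : K) {k : ℕ} (hk : 1 ≤ k) :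
    jordanCount u s k = (Finset.univ.filter fun i => k ≤ (P i).rootMultiplicity s).card := by
  rw [jordanCount, hP.finrank_ker_pow, hP.finrank_ker_pow, Finset.card_filter]
  push_cast
  rw [← Finset.sum_sub_distrib]
  refine Finset.sum_congr rfl fun i _ => ?_
  split_ifs <;> omega

theorem monotone_rootMultiplicity (hP : IsElementaryFactors u P) (s : K) :
    Monotone fun i => (P i).rootMultiplicity s := fun i j hij =>
  rootMultiplicity_le_rootMultiplicity_of_dvd (hP.1 j).1.ne_zero (hP.2.1 i j hij) s

end IsElementaryFactors

theorem le_add_one_of_card_le {n : ℕ} {l m : Fin n → ℕ} (hl : Monotone l)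
    (hm : Monotone m)
    (h : ∀ k, 1 ≤ k → (Finset.univ.filter fun i => k + 1 ≤ l i).card ≤
      (Finset.univ.filter fun i => k ≤ m i).card) (i : Fin n) : l i ≤ m i + 1 := by
  by_contra! hlt
  have hIci : Finset.Ici i ⊆ Finset.univ.filter fun j => m i + 1 + 1 ≤ l j := fun j hj =>
    Finset.mem_filter.2 ⟨Finset.mem_univ j, hlt.trans_le (hl (Finset.mem_Ici.1 hj))⟩
  have hIoi : (Finset.univ.filter fun j => m i + 1 ≤ m j) ⊆ Finset.Ioi i := fun j hj =>
    Finset.mem_Ioi.2 (hm.reflect_lt (Nat.lt_of_succ_le (Finset.mem_filter.1 hj).2))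
  have hcard := ((Finset.card_le_card hIci).trans (h (m i + 1) (Nat.le_add_left _ _))).trans
    (Finset.card_le_card hIoi)
  rw [Fin.card_Ici, Fin.card_Ioi] at hcard
  have := i.isLt
  omega

end JordanCount

section RootsPart

variable {K : Type*} [Field K] {S : Set K} {p q : K[X]}

theorem rootsPart_monic (S : Set K) (p : K[X]) : (rootsPart S p).Monic :=
  monic_multiset_prod_of_monic _ _ fun a _ => monic_X_sub_C a

theorem rootsPart_dvd (S : Set K) (p : K[X]) : rootsPart S p ∣ p := by
  classical
  exact (Multiset.prod_dvd_prod_of_le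
    (Multiset.map_le_map (Multiset.filter_le _ _))).trans (prod_multiset_X_sub_C_dvd p)

theorem rootsPart_mul_rootFreePart (S : Set K) (p : K[X]) :
    rootsPart S p * rootFreePart S p = p := by
  have h := modByMonic_add_div p (rootsPart S p)
  rwa [(modByMonic_eq_zero_iff_dvd (rootsPart_monic S p)).2 (rootsPart_dvd S p), zero_add] at h

theorem rootsPart_dvd_rootsPart (hq : q ≠ 0) (h : p ∣ q) : rootsPart S p ∣ rootsPart S q := by
  classical
  exact Multiset.prod_dvd_prod_of_le
    (Multiset.map_le_map (Multiset.filter_le_filter _ (roots.le_of_dvd hq h)))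

theorem rootsPart_eq_prod (hS : S.Finite) (p : K[X]) :
    rootsPart S p = ∏ s ∈ hS.toFinset, (X - C s) ^ p.rootMultiplicity s := by
  classical
  rw [rootsPart, Finset.prod_multiset_map_count]
  refine (Finset.prod_subset (fun s hs => ?_) fun s _ hs => ?_).trans
    (Finset.prod_congr rfl fun s hs => ?_)
  · rw [Multiset.mem_toFinset, Multiset.mem_filter] at hs
    exact hS.mem_toFinset.2 hs.2
  · rw [Multiset.count_eq_zero.2 fun h => hs (Multiset.mem_toFinset.2 h), pow_zero]
  · rw [Multiset.count_filter, if_pos (hS.mem_toFinset.1 hs), count_roots]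

theorem not_isRoot_rootFreePart (hp : p ≠ 0) {a : K} (ha : a ∈ S) :
    ¬ (rootFreePart S p).IsRoot a := by
  classical
  have hmul := rootsPart_mul_rootFreePart S p
  have hne : rootsPart S p * rootFreePart S p ≠ 0 := hmul.symm ▸ hp
  have hroots : p.roots = p.roots.filter (· ∈ S) + (rootFreePart S p).roots := by
    conv_lhs => rw [← hmul, roots_mul hne, rootsPart, roots_multiset_prod_X_sub_C]
  have hcount := congrArg (Multiset.count a) hroots
  rw [Multiset.count_add, Multiset.count_filter_of_pos ha, left_eq_add, count_roots,
    rootMultiplicity_eq_zero_iff] at hcount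
  exact fun ha => right_ne_zero_of_mul hne (hcount ha)

theorem isCoprime_rootsPart_of_not_isRoot (hq : ∀ a ∈ S, ¬ q.IsRoot a) :
    IsCoprime (rootsPart S p) q := by
  classical
  refine Multiset.prod_induction (IsCoprime · q) _ (fun _ _ => IsCoprime.mul_left)
    isCoprime_one_left fun f hf => ?_
  obtain ⟨a, ha, rfl⟩ := Multiset.mem_map.1 hf
  exact ((irreducible_X_sub_C a).coprime_iff_not_dvd).2 fun hd =>
    hq a (Multiset.mem_filter.1 ha).2 (dvd_iff_isRoot.1 hd)

theorem isCoprime_rootsPart_rootFreePart (hq : q ≠ 0) :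
    IsCoprime (rootsPart S p) (rootFreePart S q) :=
  isCoprime_rootsPart_of_not_isRoot fun _ => not_isRoot_rootFreePart hq

variable {E : Type*} [AddCommGroup E] [Module K E] [FiniteDimensional K E]

theorem nonempty_aeval'_equiv_torsionBy_prod (S : Set K) (u : Module.End K E) :
    Nonempty (Module.AEval' u ≃ₗ[K[X]]
      Submodule.torsionBy K[X] (Module.AEval' u) (rootsPart S (minpoly K u)) ×
        Module.AEval' (awayPart S u)) := by
  have hμ : minpoly K u ≠ 0 := minpoly.ne_zero (Algebra.IsIntegral.isIntegral u)
  have htop := (Module.isTorsionBy_iff_torsionBy_eq_top _).1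
    (isTorsionBy_aeval'_of_minpoly_dvd (rootsPart_mul_rootFreePart S (minpoly K u)).symm.dvd)
  obtain ⟨e⟩ := nonempty_torsionBy_mul_equiv (M := Module.AEval' u)
    (isCoprime_rootsPart_rootFreePart (S := S) (p := minpoly K u) hμ)
  obtain ⟨f⟩ := nonempty_aeval'_restrict_equiv u (rootFreePart S (minpoly K u))
  exact ⟨(LinearEquiv.ofTop _ htop).symm ≪≫ₗ e ≪≫ₗ LinearEquiv.prodCongr (.refl _ _) f.symm⟩

theorem IsElementaryFactors.nonempty_torsionBy_rootsPart_equiv {u : Module.End K E} {n : ℕ}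
    {P : Fin n → K[X]} (hP : IsElementaryFactors u P) (S : Set K) :
    Nonempty (Submodule.torsionBy K[X] (Module.AEval' u) (rootsPart S (minpoly K u)) ≃ₗ[K[X]]
      ((i : Fin n) → K[X] ⧸ Ideal.span {rootsPart S (P i)})) := by
  obtain ⟨hmonic, -, ⟨e⟩⟩ := hP
  have hμ : minpoly K u ≠ 0 := minpoly.ne_zero (Algebra.IsIntegral.isIntegral u)
  have hP0 : ∀ i, P i ≠ 0 := fun i => (hmonic i).1.ne_zero
  refine nonempty_torsionBy_equiv_pi_quotient e
    (fun i => (rootsPart_mul_rootFreePart S (P i)).symm) hP0 fun i => ?_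
  obtain ⟨f, hf⟩ := rootsPart_dvd_rootsPart (S := S) hμ
    (dvd_of_isTorsionBy_of_equiv e (isTorsionBy_aeval'_of_minpoly_dvd dvd_rfl) i)
  have hcop := isCoprime_rootsPart_rootFreePart (S := S) (p := minpoly K u) (hP0 i)
  exact ⟨f, hf, (hf ▸ hcop).of_mul_left_right⟩

end RootsPart

section Reflector

variable {R A : Type*} [CommRing R] [Ring A] [Algebra R A] {c : R} {u D : A}

/-- `D` intertwines `u` with its reflection `c - u` and is a square root of `u (c - u)`. For a
composite `u = α p + α q` and `c = 2 * α` such an element is `D = α (p - q)`, from which `p` and `q`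
are recovered as `c⁻¹ (u ± D)`. -/
def IsReflector (c : R) (u D : A) : Prop :=
  SemiconjBy D u (algebraMap R A c - u) ∧ D * D = u * (algebraMap R A c - u)

namespace IsReflector

theorem neg (h : IsReflector c u D) : IsReflector c u (-D) :=
  ⟨h.1.neg_left, by rw [neg_mul_neg, h.2]⟩

theorem algebraMap_sub (h : IsReflector c u D) : IsReflector c (algebraMap R A c - u) D :=
  ⟨by simpa using (show SemiconjBy D (algebraMap R A c) (algebraMap R A c) from
      (Algebra.commutes c D).symm).sub_right h.1,
    by rw [h.2, sub_sub_cancel, mul_sub, sub_mul, Algebra.commutes]⟩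

end IsReflector

theorem isReflector_smul_sub {α : R} {p q : A} (hp : IsIdempotentElem p) (hq : IsIdempotentElem q) :
    IsReflector (2 * α) (α • p + α • q) (α • (p - q)) := by
  simp only [IsReflector, SemiconjBy, Algebra.algebraMap_eq_smul_one, mul_add, add_mul, mul_sub,
    sub_mul, smul_sub, smul_mul_smul_comm, mul_one, one_mul, hp.eq, hq.eq]
  constructor <;> module

variable {K : Type*} [Field K] [Algebra K A]

theorem IsReflector.isIdempotentElem_inv_smul_add {c : K} (hc : c ≠ 0) (h : IsReflector c u D) :
    IsIdempotentElem (c⁻¹ • (u + D)) := by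
  have hsq : (u + D) * (u + D) = c • (u + D) :=
    calc (u + D) * (u + D) = u * u + u * D + (D * u + D * D) := by rw [add_mul, mul_add, mul_add]
      _ = u * u + u * D + ((algebraMap K A c - u) * D + u * (algebraMap K A c - u)) := by
        rw [h.1.eq, h.2]
      _ = algebraMap K A c * D + u * algebraMap K A c := by noncomm_ring
      _ = c • (u + D) := by rw [← Algebra.commutes, ← mul_add, ← Algebra.smul_def, add_comm]
  rw [IsIdempotentElem, smul_mul_smul_comm, hsq, smul_smul, mul_assoc, inv_mul_cancel₀ hc, mul_one]

theorem isComposite_iff_exists_isReflector {α : K} (hα : 2 * α ≠ 0) :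
    IsComposite α α u ↔ ∃ D, IsReflector (2 * α) u D := by
  constructor
  · rintro ⟨p, q, hp, hq, rfl⟩
    exact ⟨_, isReflector_smul_sub hp hq⟩
  · rintro ⟨D, hD⟩
    refine ⟨_, _, hD.isIdempotentElem_inv_smul_add hα, hD.neg.isIdempotentElem_inv_smul_add hα, ?_⟩
    have hinv : α * (2 * α)⁻¹ * 2 = 1 := by rw [mul_right_comm, mul_comm α, mul_inv_cancel₀ hα]
    calc u = (α * (2 * α)⁻¹ * 2) • u := by rw [hinv, one_smul]
      _ = α • (2 * α)⁻¹ • (u + D) + α • (2 * α)⁻¹ • (u + -D) := by module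

end Reflector

section Intertwining

variable {K E : Type*} [Field K] [AddCommGroup E] [Module K E]

theorem finrank_add_finrank_le_of_map [FiniteDimensional K E] (f : E →ₗ[K] E)
    {A A' B B' : Submodule K E} (hB : B ≤ B')
    (hf : ∀ x ∈ A', f x ∈ B') (hinj : ∀ x ∈ A', f x ∈ B → x ∈ A) :
    Module.finrank K A' + Module.finrank K B ≤ Module.finrank K B' + Module.finrank K A := by
  have hA' := LinearMap.finrank_range_add_finrank_ker ((B.mkQ.comp f).domRestrict A')
  have hB' := LinearMap.finrank_range_add_finrank_ker (B.mkQ.domRestrict B')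
  have hkerB' : LinearMap.ker (B.mkQ.domRestrict B') = B.comap B'.subtype := by
    ext x; simp
  rw [hkerB', (Submodule.comapSubtypeEquivOfLe hB).finrank_eq] at hB'
  have hrange : LinearMap.range ((B.mkQ.comp f).domRestrict A') ≤
      LinearMap.range (B.mkQ.domRestrict B') := by
    rintro _ ⟨x, rfl⟩
    exact ⟨⟨f x, hf x x.2⟩, rfl⟩
  have hker : (LinearMap.ker ((B.mkQ.comp f).domRestrict A')).map A'.subtype ≤ A := by
    rintro _ ⟨x, hx, rfl⟩
    exact hinj x x.2 (by simpa using hx)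
  have hle := Submodule.finrank_mono hrange
  have hle' := Submodule.finrank_mono hker
  rw [Submodule.finrank_map_subtype_eq] at hle'
  omega

theorem finrank_inf_ker_pow_add_le [FiniteDimensional K E] {D : Module.End K E}
    {M N : Submodule K E} (hD : ∀ x ∈ M, D x ∈ N) (i : ℕ) :
    Module.finrank K ↥(M ⊓ LinearMap.ker (D ^ (i + 2))) +
        Module.finrank K ↥(N ⊓ LinearMap.ker (D ^ i)) ≤
      Module.finrank K ↥(N ⊓ LinearMap.ker (D ^ (i + 1))) +
        Module.finrank K ↥(M ⊓ LinearMap.ker (D ^ (i + 1))) := by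
  have hsucc : ∀ k x, D x ∈ LinearMap.ker (D ^ k) ↔ x ∈ LinearMap.ker (D ^ (k + 1)) := fun k x => by
    rw [LinearMap.mem_ker, LinearMap.mem_ker, pow_succ, Module.End.mul_apply]
  exact finrank_add_finrank_le_of_map D
    (inf_le_inf_left N fun _ => Module.End.pow_map_zero_of_le i.le_succ)
    (fun x hx => ⟨hD x hx.1, (hsucc _ x).2 hx.2⟩) fun x hx hDx => ⟨hx.1, (hsucc _ x).1 hDx.2⟩

theorem jordanCount_algebraMap_sub (u : Module.End K E) (c s : K) (k : ℕ) :
    jordanCount (algebraMap K _ c - u) s k = jordanCount u (c - s) k := by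
  have hker : ∀ m, LinearMap.ker ((algebraMap K _ c - u - algebraMap K _ s) ^ m) =
      LinearMap.ker ((u - algebraMap K _ (c - s)) ^ m) := fun m => by
    have hneg : algebraMap K _ c - u - algebraMap K _ s = -(u - algebraMap K _ (c - s)) := by
      rw [map_sub]; abel
    rw [hneg, neg_pow]
    ext x
    rcases neg_one_pow_eq_or (Module.End K E) m with h | h <;> simp [h]
  rw [jordanCount, jordanCount, hker, hker]

namespace IsReflector

variable {c : K} {u D : Module.End K E}

theorem map_mem_ker_pow (h : IsReflector c u D) (n : ℕ) :
    ∀ x ∈ LinearMap.ker (u ^ n), D x ∈ LinearMap.ker ((algebraMap K _ c - u) ^ n) := fun x hx => by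
  rw [LinearMap.mem_ker, ← Module.End.mul_apply, ← (h.1.pow_right n).eq, Module.End.mul_apply,
    LinearMap.mem_ker.1 hx, map_zero]

theorem ker_pow_eq (hc : c ≠ 0) (h : IsReflector c u D) {k n : ℕ} (hkn : k ≤ n) :
    LinearMap.ker (u ^ k) = LinearMap.ker (u ^ n) ⊓ LinearMap.ker (D ^ (2 * k)) := by
  have hcomm : Commute u (algebraMap K _ c - u) :=
    (Algebra.commute_algebraMap_right c u).sub_right (Commute.refl u)
  have hDk : D ^ (2 * k) = (algebraMap K _ c - u) ^ k * u ^ k := by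
    rw [pow_mul, pow_two, h.2, hcomm.mul_pow, (hcomm.pow_pow k k).eq]
  have hcop : IsCoprime (X ^ n : K[X]) ((C c - X) ^ k) := by
    refine IsCoprime.pow ⟨C c⁻¹, C c⁻¹, ?_⟩
    rw [← mul_add, add_sub_cancel, ← C_mul, inv_mul_cancel₀ hc, C_1]
  have hdisj := disjoint_ker_aeval_of_isCoprime u hcop
  simp only [map_pow, aeval_X, map_sub, aeval_C] at hdisj
  ext x
  simp only [Submodule.mem_inf, LinearMap.mem_ker, hDk, Module.End.mul_apply]
  refine ⟨fun hx => ⟨Module.End.pow_map_zero_of_le hkn hx, by rw [hx, map_zero]⟩,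
    fun ⟨hx, hx'⟩ => Submodule.disjoint_def.1 hdisj _ ?_ hx'⟩
  rw [LinearMap.mem_ker, ← Module.End.mul_apply, (Commute.pow_pow_self u n k).eq,
    Module.End.mul_apply, hx, map_zero]

theorem jordanCount_zero_succ (hc : c ≠ 0) (h : IsReflector c u D) {k n : ℕ} (hkn : k + 1 ≤ n) :
    jordanCount u 0 (k + 1) =
      (Module.finrank K ↥(LinearMap.ker (u ^ n) ⊓ LinearMap.ker (D ^ (2 * k + 2))) : ℤ) -
        Module.finrank K ↥(LinearMap.ker (u ^ n) ⊓ LinearMap.ker (D ^ (2 * k))) := by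
  rw [jordanCount, map_zero, sub_zero, Nat.add_sub_cancel, h.ker_pow_eq hc hkn,
    h.ker_pow_eq hc (k.le_succ.trans hkn), mul_add_one]

variable [FiniteDimensional K E]

theorem jordanCount_succ_le (hc : c ≠ 0) (h : IsReflector c u D) {k : ℕ} (hk : 1 ≤ k) :
    jordanCount u c (k + 1) ≤ jordanCount u 0 k := by
  obtain ⟨j, rfl⟩ := Nat.exists_eq_add_of_le' hk
  have h' : IsReflector c (algebraMap K _ c - u) D := h.algebraMap_sub
  let a (i : ℕ) : ℕ := Module.finrank K ↥(LinearMap.ker (u ^ (j + 2)) ⊓ LinearMap.ker (D ^ i))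
  let b (i : ℕ) : ℕ := Module.finrank K
    ↥(LinearMap.ker ((algebraMap K _ c - u) ^ (j + 2)) ⊓ LinearMap.ker (D ^ i))
  have hab (i : ℕ) : a (i + 2) + b i ≤ b (i + 1) + a (i + 1) :=
    finrank_inf_ker_pow_add_le (h.map_mem_ker_pow (j + 2)) i
  have hba (i : ℕ) : b (i + 2) + a i ≤ a (i + 1) + b (i + 1) :=
    finrank_inf_ker_pow_add_le (by simpa only [sub_sub_cancel] using h'.map_mem_ker_pow (j + 2)) i
  have ha : jordanCount u 0 (j + 1) = a (2 * j + 2) - a (2 * j) :=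
    h.jordanCount_zero_succ hc (j + 1).le_succ
  have hb : jordanCount u c (j + 2) = b (2 * j + 4) - b (2 * j + 2) := by
    have hc' := h'.jordanCount_zero_succ hc (le_refl (j + 2))
    rwa [jordanCount_algebraMap_sub, sub_zero] at hc'
  -- The increments of `a` and `b` interlace, so increments of `b` are dominated by earlier ones
  -- of `a`.
  have h₀ : b (2 * j + 2) + a (2 * j) ≤ a (2 * j + 1) + b (2 * j + 1) := hba (2 * j)
  have h₁ : a (2 * j + 3) + b (2 * j + 1) ≤ b (2 * j + 2) + a (2 * j + 2) := hab (2 * j + 1)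
  have h₁' : b (2 * j + 3) + a (2 * j + 1) ≤ a (2 * j + 2) + b (2 * j + 2) := hba (2 * j + 1)
  have h₂ : b (2 * j + 4) + a (2 * j + 2) ≤ a (2 * j + 3) + b (2 * j + 3) := hba (2 * j + 2)
  rw [ha, hb]
  omega

theorem intertwined (hc : c ≠ 0) (h : IsReflector c u D) :
    Intertwined (jordanCount u 0) (jordanCount u c) := fun k hk => by
  refine ⟨h.jordanCount_succ_le hc hk, ?_⟩
  simpa only [jordanCount_algebraMap_sub, sub_self, sub_zero] using
    h.algebraMap_sub.jordanCount_succ_le hc hk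

end IsReflector

end Intertwining

section SubstReflect

variable {R : Type*} [CommRing R]

/-- The substitution `X ↦ c - X`, as an endomorphism of the polynomial ring. -/
noncomputable def substReflect (c : R) : R[X] →+* R[X] := compRingHom (C c - X)

theorem substReflect_X (c : R) : substReflect c X = C c - X := by
  rw [substReflect, coe_compRingHom_apply, X_comp]

theorem substReflect_C (c a : R) : substReflect c (C a) = C a := by
  rw [substReflect, coe_compRingHom_apply, C_comp]

theorem substReflect_substReflect (c : R) (f : R[X]) : substReflect c (substReflect c f) = f := by
  rw [substReflect, coe_compRingHom_apply, coe_compRingHom_apply, comp_assoc, sub_comp, C_comp,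
    X_comp, sub_sub_cancel, comp_X]

variable {A : Type*} [Ring A] [Algebra R A]

theorem semiconjBy_aeval {D u v : A} (h : SemiconjBy D u v) (f : R[X]) :
    SemiconjBy D (aeval u f) (aeval v f) := by
  induction f using Polynomial.induction_on' with
  | add p q hp hq => simpa only [map_add] using hp.add_right hq
  | monomial n a =>
    simpa only [aeval_monomial] using
      (show SemiconjBy D (algebraMap R A a) (algebraMap R A a) from
        (Algebra.commutes a D).symm).mul_right (h.pow_right n)

theorem IsReflector.semiconjBy_aeval_substReflect {c : R} {u D : A} (h : IsReflector c u D)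
    (f : R[X]) : SemiconjBy D (aeval u f) (aeval u (substReflect c f)) := by
  simpa only [substReflect, coe_compRingHom_apply, aeval_comp, map_sub, aeval_C, aeval_X] using
    semiconjBy_aeval h.1 f

theorem IsReflector.exists_involution {c : R} {u D : A} (h : IsReflector c u D) (hu : IsUnit u)
    (hu' : IsUnit (algebraMap R A c - u)) :
    ∃ s, s * s = 1 ∧ SemiconjBy s u (algebraMap R A c - u) := by
  obtain ⟨v, hv⟩ := hu'
  obtain ⟨u, rfl⟩ := hu
  have huv : Commute (u : A) v := by
    rw [hv]
    exact (Algebra.commute_algebraMap_right c (u : A)).sub_right (Commute.refl _)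
  have hDu : SemiconjBy D (u : A) v := hv ▸ h.1
  have hDD : D * D = u * v := hv ▸ h.2
  refine ⟨↑u⁻¹ * D, ?_, hv ▸ SemiconjBy.mul_left huv.units_inv_left hDu⟩
  calc ↑u⁻¹ * D * (↑u⁻¹ * D) = ↑u⁻¹ * (D * ↑u⁻¹) * D := by simp only [mul_assoc]
    _ = ↑u⁻¹ * (↑v⁻¹ * (D * D)) := by rw [hDu.units_inv_right.eq]; simp only [mul_assoc]
    _ = 1 := by rw [hDD, huv.eq, Units.inv_mul_cancel_left, Units.inv_mul]

end SubstReflect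

section AwayPart

variable {K E : Type*} [Field K] [AddCommGroup E] [Module K E] [FiniteDimensional K E]
  {S : Set K} {u : Module.End K E}

theorem isUnit_awayPart_sub_algebraMap {a : K} (ha : a ∈ S) :
    IsUnit (awayPart S u - algebraMap K _ a) := by
  have hμ : minpoly K u ≠ 0 := minpoly.ne_zero (Algebra.IsIntegral.isIntegral u)
  have hcop : IsCoprime (X - C a) (rootFreePart S (minpoly K u)) :=
    (irreducible_X_sub_C a).coprime_iff_not_dvd.2 fun h =>
      not_isRoot_rootFreePart hμ ha (dvd_iff_isRoot.1 h)
  rw [LinearMap.isUnit_iff_ker_eq_bot, LinearMap.ker_eq_bot']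
  intro x hx
  refine Subtype.ext (Submodule.disjoint_def.1 (disjoint_ker_aeval_of_isCoprime u hcop) x ?_ x.2)
  rw [LinearMap.mem_ker, map_sub, aeval_X, aeval_C]
  exact congrArg Subtype.val hx

namespace IsReflector

variable {c : K} {D : Module.End K E}

theorem map_mem_awaySubspace (h : IsReflector c u D) (hS : ∀ a ∈ S, c - a ∈ S) :
    ∀ x ∈ awaySubspace S u, D x ∈ awaySubspace S u := by
  intro x hx
  have hμ : minpoly K u ≠ 0 := minpoly.ne_zero (Algebra.IsIntegral.isIntegral u)
  let Q := rootFreePart S (minpoly K u)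
  have hcop : IsCoprime (rootsPart S (minpoly K u)) (substReflect c Q) :=
    isCoprime_rootsPart_of_not_isRoot fun a ha hroot =>
      not_isRoot_rootFreePart hμ (hS a ha) <| by
        simpa only [substReflect, coe_compRingHom_apply, IsRoot.def, eval_comp, eval_sub, eval_C,
          eval_X] using hroot
  have hDx : aeval u (substReflect c Q) (D x) = 0 := by
    rw [← Module.End.mul_apply, ← (h.semiconjBy_aeval_substReflect Q).eq, Module.End.mul_apply,
      LinearMap.mem_ker.1 hx, map_zero]
  refine Submodule.disjoint_def.1 (disjoint_ker_aeval_of_isCoprime u hcop) _ ?_ ?_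
  · rw [LinearMap.mem_ker, ← Module.End.mul_apply, ← map_mul, rootsPart_mul_rootFreePart,
      minpoly.aeval, LinearMap.zero_apply]
  · rw [LinearMap.mem_ker, ← Module.End.mul_apply, ← map_mul, mul_comm, map_mul,
      Module.End.mul_apply, hDx, map_zero]

theorem exists_awayPart (h : IsReflector c u D) (hS : ∀ a ∈ S, c - a ∈ S) :
    ∃ D', IsReflector c (awayPart S u) D' :=
  ⟨D.restrict (h.map_mem_awaySubspace hS),
    LinearMap.ext fun x => Subtype.ext (LinearMap.congr_fun h.1 x),
    LinearMap.ext fun x => Subtype.ext (LinearMap.congr_fun h.2 x)⟩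

theorem exists_involution_awayPart (h : IsReflector c u D) (hS : ∀ a ∈ S, c - a ∈ S)
    (h0 : 0 ∈ S) :
    ∃ s, s * s = 1 ∧ SemiconjBy s (awayPart S u) (algebraMap K _ c - awayPart S u) := by
  obtain ⟨D', hD'⟩ := h.exists_awayPart hS
  refine hD'.exists_involution ?_ ?_
  · simpa only [map_zero, sub_zero] using isUnit_awayPart_sub_algebraMap h0
  · rw [IsUnit.sub_iff]
    exact isUnit_awayPart_sub_algebraMap (by simpa only [sub_zero] using hS 0 h0)

end IsReflector

end AwayPart

section SemilinearQuotient

variable {R : Type*} [CommRing R]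

/-- The semilinear map `R ⧸ (a) → R ⧸ (b)` sending the class of `f` to the class of `c * σ f`. -/
def quotMul (σ : R →+* R) {a b : R} (c : R) (h : b ∣ c * σ a) :
    (R ⧸ Ideal.span {a}) →ₛₗ[σ] (R ⧸ Ideal.span {b}) :=
  Submodule.mapQ (Ideal.span {a}) (Ideal.span {b})
    { toFun := fun f => c * σ f
      map_add' := fun f g => by rw [map_add, mul_add]
      map_smul' := fun f g => by rw [smul_eq_mul, map_mul, mul_left_comm, smul_eq_mul] }
    fun f hf => by
      obtain ⟨r, rfl⟩ := Ideal.mem_span_singleton.1 hf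
      refine Ideal.mem_span_singleton.2 ((h.mul_right (σ r)).trans (dvd_of_eq ?_))
      rw [LinearMap.coe_mk, AddHom.coe_mk, map_mul, mul_assoc]

theorem quotMul_mk (σ : R →+* R) {a b : R} (c : R) (h : b ∣ c * σ a) (f : R) :
    quotMul σ c h (Ideal.Quotient.mk _ f) = Ideal.Quotient.mk (Ideal.span {b}) (c * σ f) := rfl

end SemilinearQuotient

section EvenExtension

variable {K : Type*} [Field K] {α : K}

/-- The substitution `X ↦ (X - α)²`, whose image is the ring of polynomials in `(X - α)²`. -/
noncomputable def evenSubst (α : K) : K[X] →+* K[X] := compRingHom ((X - C α) ^ 2)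

theorem natDegree_evenSubst (α : K) (f : K[X]) : (evenSubst α f).natDegree = f.natDegree * 2 := by
  rw [evenSubst, coe_compRingHom_apply, natDegree_comp, natDegree_pow, natDegree_X_sub_C]

theorem monic_evenSubst {f : K[X]} (hf : f.Monic) : (evenSubst α f).Monic :=
  hf.comp ((monic_X_sub_C α).pow 2) (by
    rw [natDegree_pow, natDegree_X_sub_C]
    exact two_ne_zero)

theorem evenSubst_X (α : K) : evenSubst α X = (X - C α) ^ 2 := by
  rw [evenSubst, coe_compRingHom_apply, X_comp]

theorem evenSubst_C (α a : K) : evenSubst α (C a) = C a := by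
  rw [evenSubst, coe_compRingHom_apply, C_comp]

theorem eq_zero_of_evenSubst_add_eq_zero {f g : K[X]}
    (h : evenSubst α f + (X - C α) * evenSubst α g = 0) : f = 0 ∧ g = 0 := by
  have hinj : ∀ p, evenSubst α p = 0 → p = 0 := fun p hp =>
    (comp_eq_zero_iff.1 hp).resolve_right fun hc => by
      have := congrArg natDegree hc.2
      rw [natDegree_pow, natDegree_X_sub_C, natDegree_C] at this
      omega
  have hg : g = 0 := by
    by_contra hg
    -- The two summands have degrees of different parity.
    have hdeg := congrArg natDegree (eq_neg_of_add_eq_zero_left h)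
    rw [natDegree_neg, natDegree_mul (X_sub_C_ne_zero α) (mt (hinj g) hg), natDegree_X_sub_C,
      natDegree_evenSubst, natDegree_evenSubst] at hdeg
    omega
  rw [hg, map_zero, mul_zero, add_zero] at h
  exact ⟨hinj f h, hg⟩

theorem exists_eq_evenSubst_add (α : K) (f : K[X]) :
    ∃ a b, f = evenSubst α a + (X - C α) * evenSubst α b := by
  induction f using Polynomial.induction_on with
  | C a => exact ⟨C a, 0, by rw [evenSubst_C, map_zero, mul_zero, add_zero]⟩
  | add p q hp hq =>
    obtain ⟨a, b, rfl⟩ := hp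
    obtain ⟨a', b', rfl⟩ := hq
    exact ⟨a + a', b + b', by simp only [map_add]; ring⟩
  | monomial n r ih =>
    obtain ⟨a, b, hab⟩ := ih
    refine ⟨C α * a + X * b, a + C α * b, ?_⟩
    rw [pow_succ, ← mul_assoc, hab]
    simp only [map_add, map_mul, evenSubst_X, evenSubst_C]
    ring

section EvenSum

variable {M N : Type*} [AddCommGroup M] [Module K[X] M] [AddCommGroup N] [Module K[X] N]

/-- The map `(x, y) ↦ j x + (X - α) • j y` induced by a semilinear map `j`. -/
noncomputable def evenSum (j : M →ₛₗ[evenSubst α] N) : M × M →+ N :=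
  j.toAddMonoidHom.coprod
    ((DistribSMul.toAddMonoidHom N (X - C α : K[X])).comp j.toAddMonoidHom)

theorem evenSum_apply (j : M →ₛₗ[evenSubst α] N) (x : M × M) :
    evenSum j x = j x.1 + (X - C α : K[X]) • j x.2 := rfl

theorem smul_evenSum (j : M →ₛₗ[evenSubst α] N) (f g : K[X]) (x : M × M) :
    (evenSubst α f + (X - C α) * evenSubst α g) • evenSum j x =
      evenSum j (f • x.1 + (X * g) • x.2, g • x.1 + f • x.2) := by
  simp only [evenSum_apply, map_add, map_smulₛₗ, map_mul, evenSubst_X]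
  module

end EvenSum

/-- The `K[X]`-module `N` is the extension of scalars of `M` along `X ↦ (X - α)²`. As `K[X]` is free
with basis `1, X - α` over the polynomials in `(X - α)²`, this means `N = M ⊕ (X - α) M`. -/
def IsEvenExtension (α : K) (M N : Type*) [AddCommGroup M] [Module K[X] M] [AddCommGroup N]
    [Module K[X] N] : Prop :=
  ∃ j : M →ₛₗ[evenSubst α] N, Function.Bijective (evenSum j)

namespace IsEvenExtension

variable {M M' N N' : Type*} [AddCommGroup M] [Module K[X] M] [AddCommGroup M'] [Module K[X] M']
  [AddCommGroup N] [Module K[X] N] [AddCommGroup N'] [Module K[X] N']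

theorem congr_left (h : IsEvenExtension α M N) (e : M' ≃ₗ[K[X]] M) : IsEvenExtension α M' N := by
  obtain ⟨j, hj⟩ := h
  let j' : M' →ₛₗ[evenSubst α] N := j.comp e.toLinearMap
  exact ⟨j', hj.comp (e.toEquiv.prodCongr e.toEquiv).bijective⟩

theorem pi {ι : Type*} {M N : ι → Type*} [∀ i, AddCommGroup (M i)] [∀ i, Module K[X] (M i)]
    [∀ i, AddCommGroup (N i)] [∀ i, Module K[X] (N i)] (h : ∀ i, IsEvenExtension α (M i) (N i)) :
    IsEvenExtension α (∀ i, M i) (∀ i, N i) := by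
  choose j hj using h
  let j' : (∀ i, M i) →ₛₗ[evenSubst α] ∀ i, N i :=
    { toFun := fun x i => j i (x i)
      map_add' := fun x y => funext fun i => map_add (j i) (x i) (y i)
      map_smul' := fun f x => funext fun i => map_smulₛₗ (j i) f (x i) }
  refine ⟨j', fun x y hxy => ?_, fun z => ?_⟩
  · have hi i : (x.1 i, x.2 i) = (y.1 i, y.2 i) := (hj i).1 (congrFun hxy i)
    exact Prod.ext (funext fun i => congrArg Prod.fst (hi i))
      (funext fun i => congrArg Prod.snd (hi i))
  · choose x hx using fun i => (hj i).2 (z i)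
    exact ⟨(fun i => (x i).1, fun i => (x i).2), funext hx⟩

theorem quotient (α : K) (R : K[X]) :
    IsEvenExtension α (K[X] ⧸ Ideal.span {R}) (K[X] ⧸ Ideal.span {evenSubst α R}) := by
  let j := quotMul (evenSubst α) (a := R) 1 (one_mul (evenSubst α R)).symm.dvd
  have hj (f g : K[X]) : evenSum j (Ideal.Quotient.mk _ f, Ideal.Quotient.mk _ g) =
      Ideal.Quotient.mk _ (evenSubst α f + (X - C α) * evenSubst α g) := by
    rw [evenSum_apply, quotMul_mk, quotMul_mk, one_mul, one_mul, map_add]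
    rfl
  refine ⟨j, (injective_iff_map_eq_zero _).2 ?_, fun y => ?_⟩
  · rintro ⟨x, y⟩ hxy
    obtain ⟨f, rfl⟩ := Ideal.Quotient.mk_surjective x
    obtain ⟨g, rfl⟩ := Ideal.Quotient.mk_surjective y
    rw [hj, Ideal.Quotient.eq_zero_iff_dvd] at hxy
    obtain ⟨q, hq⟩ := hxy
    obtain ⟨a, b, rfl⟩ := exists_eq_evenSubst_add α q
    obtain ⟨hf, hg⟩ := eq_zero_of_evenSubst_add_eq_zero
      (show evenSubst α (f - R * a) + (X - C α) * evenSubst α (g - R * b) = 0 by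
        simp only [map_sub, map_mul]
        linear_combination hq)
    exact Prod.ext ((Ideal.Quotient.eq_zero_iff_dvd _ _).2 ⟨a, sub_eq_zero.1 hf⟩)
      ((Ideal.Quotient.eq_zero_iff_dvd _ _).2 ⟨b, sub_eq_zero.1 hg⟩)
  · obtain ⟨f, rfl⟩ := Ideal.Quotient.mk_surjective y
    obtain ⟨a, b, rfl⟩ := exists_eq_evenSubst_add α f
    exact ⟨(Ideal.Quotient.mk _ a, Ideal.Quotient.mk _ b), hj a b⟩

theorem nonempty_equiv (h : IsEvenExtension α M N) (h' : IsEvenExtension α M N') :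
    Nonempty (N ≃ₗ[K[X]] N') := by
  obtain ⟨j, hj⟩ := h
  obtain ⟨j', hj'⟩ := h'
  let e := (AddEquiv.ofBijective (evenSum j) hj).symm.trans (AddEquiv.ofBijective (evenSum j') hj')
  have he (x : M × M) : e (evenSum j x) = evenSum j' x :=
    congrArg (evenSum j') ((AddEquiv.ofBijective (evenSum j) hj).symm_apply_apply x)
  refine ⟨{ e with map_smul' := fun f y => ?_ }⟩
  obtain ⟨x, rfl⟩ := hj.2 y
  obtain ⟨a, b, rfl⟩ := exists_eq_evenSubst_add α f
  change e _ = (evenSubst α a + (X - C α) * evenSubst α b) • e _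
  rw [smul_evenSum, he, he, smul_evenSum]

end IsEvenExtension

variable {E F : Type*} [AddCommGroup E] [Module K E] [AddCommGroup F] [Module K F]

theorem IsEvenExtension.exists_elementaryFactors [FiniteDimensional K E] {v : Module.End K E}
    {w : Module.End K F} (h : IsEvenExtension α (Module.AEval' v) (Module.AEval' w)) :
    ∃ (N : ℕ) (P : Fin N → K[X]), IsElementaryFactors w P ∧
      ∀ i, ∃ Q : K[X], P i = Q.comp ((X - C α) ^ 2) := by
  obtain ⟨n, R, hmonic, hdvd, ⟨e⟩⟩ := _root_.exists_elementaryFactors v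
  have hquot : IsEvenExtension α ((i : Fin n) → K[X] ⧸ Ideal.span {R i})
      ((i : Fin n) → K[X] ⧸ Ideal.span {evenSubst α (R i)}) := .pi fun i => .quotient α (R i)
  refine ⟨n, fun i => evenSubst α (R i), ⟨fun i => ⟨monic_evenSubst (hmonic i).1, ?_⟩,
    fun i j hij => map_dvd (evenSubst α) (hdvd i j hij),
    h.nonempty_equiv (hquot.congr_left e)⟩, fun i => ⟨R i, rfl⟩⟩
  rw [natDegree_evenSubst]
  exact Nat.mul_pos (hmonic i).2 two_pos

theorem map_aeval_apply_of_comp_eq {v : Module.End K E} {z : Module.End K F} {i : E →ₗ[K] F}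
    (h : i ∘ₗ v = z ∘ₗ i) (f : K[X]) (x : E) : i (aeval v f x) = aeval z f (i x) := by
  induction f using Polynomial.induction_on generalizing x with
  | C a => simp only [aeval_C, Module.algebraMap_end_apply, map_smul]
  | add f g hf hg => simp only [map_add, LinearMap.add_apply, hf, hg]
  | monomial n a ih =>
    have hx : i (v x) = z (i x) := LinearMap.congr_fun h x
    rw [pow_succ, ← mul_assoc, map_mul (aeval v) _ X, Module.End.mul_apply, ih, aeval_X, hx,
      map_mul (aeval z) _ X, Module.End.mul_apply, aeval_X]

theorem isEvenExtension_aeval' {v : Module.End K E} {w : Module.End K F} {i : E →ₗ[K] F}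
    (hi : i ∘ₗ v = ((w - algebraMap K _ α) ^ 2) ∘ₗ i)
    (hbij : Function.Bijective fun x : E × E => i x.1 + (w - algebraMap K _ α) (i x.2)) :
    IsEvenExtension α (Module.AEval' v) (Module.AEval' w) := by
  let j : Module.AEval' v →ₛₗ[evenSubst α] Module.AEval' w :=
    { toFun := fun x => Module.AEval'.of w (i ((Module.AEval'.of v).symm x))
      map_add' := fun x y => by rw [map_add, map_add, map_add]
      map_smul' := fun f x => by
        have hf : aeval w (evenSubst α f) = aeval ((w - algebraMap K _ α) ^ 2) f := by
          rw [evenSubst, coe_compRingHom_apply, aeval_comp, map_pow, map_sub, aeval_X, aeval_C]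
        rw [← Module.AEval.of_aeval_smul, hf]
        exact congrArg _ (map_aeval_apply_of_comp_eq hi f _) }
  have hj (x y : E) : evenSum j (Module.AEval'.of v x, Module.AEval'.of v y) =
      Module.AEval'.of w (i x + (w - algebraMap K _ α) (i y)) := by
    have hX : aeval w (X - C α) = w - algebraMap K _ α := by rw [map_sub, aeval_X, aeval_C]
    rw [evenSum_apply, map_add, ← hX]
    rfl
  have hcomp : evenSum j = Module.AEval'.of w ∘
      (fun x : E × E => i x.1 + (w - algebraMap K _ α) (i x.2)) ∘
      Prod.map (Module.AEval'.of v).symm (Module.AEval'.of v).symm := funext fun x => hj x.1 x.2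
  refine ⟨j, ?_⟩
  rw [hcomp]
  exact (Module.AEval'.of w).bijective.comp (hbij.comp
    ((Module.AEval'.of v).symm.bijective.prodMap (Module.AEval'.of v).symm.bijective))

section Involution

variable {s z : Module.End K F}

theorem map_sq_mem_ker_sub_one (h : SemiconjBy s z (-z)) :
    ∀ x ∈ LinearMap.ker (s - 1), (z ^ 2) x ∈ LinearMap.ker (s - 1) := fun x hx => by
  have hsq : s * z ^ 2 = z ^ 2 * s := by simpa only [neg_sq] using (h.pow_right 2).eq
  rw [LinearMap.mem_ker, ← Module.End.mul_apply, sub_mul, hsq, one_mul, ← mul_sub_one,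
    Module.End.mul_apply, LinearMap.mem_ker.1 hx, map_zero]

theorem bijective_ker_sub_one_add (h2 : (2 : K) ≠ 0) (hs : s * s = 1) (h : SemiconjBy s z (-z))
    (hz : IsUnit z) : Function.Bijective
      fun x : LinearMap.ker (s - 1) × LinearMap.ker (s - 1) => (x.1 : F) + z x.2 := by
  obtain ⟨hinj, hsurj⟩ := (Module.End.isUnit_iff z).1 hz
  have hsz (x : F) : s (z x) = -z (s x) := LinearMap.congr_fun h x
  have hss (x : F) : s (s x) = x := LinearMap.congr_fun hs x
  have hmem {x : F} : x ∈ LinearMap.ker (s - 1) ↔ s x = x := by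
    rw [LinearMap.mem_ker, LinearMap.sub_apply, Module.End.one_apply, sub_eq_zero]
  constructor
  · rintro ⟨⟨x, hx⟩, ⟨y, hy⟩⟩ ⟨⟨x', hx'⟩, ⟨y', hy'⟩⟩ (hxy : x + z y = x' + z y')
    rw [hmem] at hx hy hx' hy'
    have hsxy := congrArg s hxy
    simp only [map_add, hsz, hx, hy, hx', hy'] at hsxy
    have hx2 : (2 : K) • x = (2 : K) • x' :=
      calc (2 : K) • x = (x + z y) + (x + -z y) := by module
        _ = (x' + z y') + (x' + -z y') := by rw [hxy, hsxy]
        _ = (2 : K) • x' := by module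
    have hxx' : x = x' := smul_right_injective F h2 hx2
    subst hxx'
    have hyy' : y = y' := hinj (add_left_cancel hxy)
    subst hyy'
    rfl
  · intro t
    obtain ⟨y, hy⟩ := hsurj ((2 : K)⁻¹ • (t - s t))
    refine ⟨(⟨(2 : K)⁻¹ • (t + s t), hmem.2 ?_⟩, ⟨y, hmem.2 (hinj ?_)⟩), ?_⟩
    · rw [map_smul, map_add, hss, add_comm]
    · rw [← neg_eq_iff_eq_neg.2 (hsz y), hy, map_smul, map_sub, hss, ← smul_neg, neg_sub]
    · change (2 : K)⁻¹ • (t + s t) + z y = t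
      rw [hy, ← smul_add, add_add_sub_cancel, ← two_smul K t, inv_smul_smul₀ h2]

theorem exists_elementaryFactors_of_semiconjBy [FiniteDimensional K F] {w : Module.End K F}
    (h2 : (2 : K) ≠ 0) (hs : s * s = 1) (h : SemiconjBy s w (algebraMap K _ (2 * α) - w))
    (hw : IsUnit (w - algebraMap K _ α)) :
    ∃ (N : ℕ) (P : Fin N → K[X]), IsElementaryFactors w P ∧
      ∀ i, ∃ Q : K[X], P i = Q.comp ((X - C α) ^ 2) := by
  have hz : SemiconjBy s (w - algebraMap K _ α) (-(w - algebraMap K _ α)) := by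
    have hα := h.sub_right (Algebra.commutes α s).symm
    rwa [two_mul, map_add, sub_right_comm, add_sub_cancel_right, ← neg_sub w] at hα
  let v := ((w - algebraMap K _ α) ^ 2).restrict (map_sq_mem_ker_sub_one hz)
  have hv : IsEvenExtension α (Module.AEval' v) (Module.AEval' w) :=
    isEvenExtension_aeval' (i := (LinearMap.ker (s - 1)).subtype) rfl
      (bijective_ker_sub_one_add h2 hs hz hw)
  exact hv.exists_elementaryFactors

end Involution

end EvenExtension

section HasReflection

variable {R : Type*} [CommRing R] {c : R}

/-- The `R[X]`-module `M` admits a square root of `X (c - X)` that is semilinear with respect to the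
substitution `X ↦ c - X`: the module version of the existence of a reflector. -/
def HasReflection (c : R) (M : Type*) [AddCommGroup M] [Module R[X] M] : Prop :=
  ∃ D : M →ₛₗ[substReflect c] M, ∀ m, D (D m) = (X * (C c - X) : R[X]) • m

namespace HasReflection

variable {M N : Type*} [AddCommGroup M] [Module R[X] M] [AddCommGroup N] [Module R[X] N]

theorem congr (h : HasReflection c M) (e : M ≃ₗ[R[X]] N) : HasReflection c N := by
  obtain ⟨D, hD⟩ := h
  refine ⟨e.toLinearMap.comp (D.comp e.symm.toLinearMap), fun m => ?_⟩
  simp [hD]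

theorem pi {ι : Type*} {M : ι → Type*} [∀ i, AddCommGroup (M i)] [∀ i, Module R[X] (M i)]
    (h : ∀ i, HasReflection c (M i)) : HasReflection c (∀ i, M i) := by
  choose D hD using h
  exact ⟨{ toFun := fun m i => D i (m i)
           map_add' := fun x y => funext fun i => map_add (D i) (x i) (y i)
           map_smul' := fun f x => funext fun i => map_smulₛₗ (D i) f (x i) },
    fun m => funext fun i => hD i (m i)⟩

theorem prod (hM : HasReflection c M) (hN : HasReflection c N) : HasReflection c (M × N) := by
  obtain ⟨D, hD⟩ := hM
  obtain ⟨D', hD'⟩ := hN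
  exact ⟨{ toFun := fun m => (D m.1, D' m.2)
           map_add' := fun x y => Prod.ext (map_add D x.1 y.1) (map_add D' x.2 y.2)
           map_smul' := fun f x => Prod.ext (map_smulₛₗ D f x.1) (map_smulₛₗ D' f x.2) },
    fun m => Prod.ext (hD m.1) (hD' m.2)⟩

theorem quotient {p g : R[X]} (hg : g * substReflect c g = X * (C c - X))
    (hp : p ∣ g * substReflect c p) : HasReflection c (R[X] ⧸ Ideal.span {p}) := by
  refine ⟨quotMul (substReflect c) g hp, fun m => ?_⟩
  obtain ⟨f, rfl⟩ := Ideal.Quotient.mk_surjective m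
  rw [quotMul_mk, quotMul_mk, map_mul (substReflect c), substReflect_substReflect, ← mul_assoc, hg]
  rfl

theorem quotient_pow_mul_pow_mul {a b : ℕ} {q : R[X]} (hab : a ≤ b + 1) (hba : b ≤ a + 1)
    (hq : q ∣ substReflect c q) :
    HasReflection c (R[X] ⧸ Ideal.span {X ^ a * (X - C c) ^ b * q}) := by
  have hsubst : substReflect c (X ^ a * (X - C c) ^ b * q) =
      (C c - X) ^ a * (-X) ^ b * substReflect c q := by
    rw [map_mul, map_mul, map_pow, map_pow, map_sub, substReflect_X, substReflect_C,
      sub_sub_cancel_left]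
  have hX (k : ℕ) : (X : R[X]) ^ k ∣ (-X) ^ k := pow_dvd_pow_of_dvd (dvd_neg.2 dvd_rfl) k
  have hXc (k : ℕ) : (X - C c) ^ k ∣ (C c - X : R[X]) ^ k :=
    pow_dvd_pow_of_dvd (dvd_sub_comm.1 dvd_rfl) k
  rcases le_total b a with hle | hle
  · refine quotient (g := X) (by rw [substReflect_X]) ?_
    calc X ^ a * (X - C c) ^ b * q ∣ (X * (-X) ^ b) * (C c - X) ^ a * substReflect c q := by
          refine mul_dvd_mul (mul_dvd_mul ?_ ?_) hq
          · exact (pow_dvd_pow X hab).trans (pow_succ' (X : R[X]) b ▸ mul_dvd_mul_left X (hX b))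
          · exact (pow_dvd_pow _ hle).trans (hXc a)
      _ = X * substReflect c (X ^ a * (X - C c) ^ b * q) := by rw [hsubst]; ring
  · refine quotient (g := C c - X)
      (by rw [map_sub, substReflect_X, substReflect_C, sub_sub_cancel, mul_comm]) ?_
    calc X ^ a * (X - C c) ^ b * q ∣ (-X) ^ b * (C c - X) ^ (a + 1) * substReflect c q :=
          mul_dvd_mul (mul_dvd_mul ((pow_dvd_pow X hle).trans (hX b))
            ((pow_dvd_pow _ hba).trans (hXc (a + 1)))) hq
      _ = (C c - X) * substReflect c (X ^ a * (X - C c) ^ b * q) := by rw [hsubst]; ring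

theorem exists_isReflector {E : Type*} [AddCommGroup E] [Module R E] {u : Module.End R E}
    (h : HasReflection c (Module.AEval' u)) : ∃ D, IsReflector c u D := by
  obtain ⟨D, hD⟩ := h
  let of := Module.AEval'.of u
  have hof (f : R[X]) (x : E) : of (aeval u f x) = f • of x := Module.AEval.of_aeval_smul u f x
  have hC (a : R) (x : E) : of (a • x) = (C a : R[X]) • of x := by
    rw [← hof, aeval_C, Module.algebraMap_end_apply]
  let D' : Module.End R E :=
    { toFun := fun x => of.symm (D (of x))
      map_add' := fun x y => by rw [map_add, map_add, map_add]
      map_smul' := fun a x => of.injective <| by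
        rw [hC, map_smulₛₗ, substReflect_C, of.apply_symm_apply, RingHom.id_apply, hC,
          of.apply_symm_apply] }
  have hD' (x : E) : of (D' x) = D (of x) := of.apply_symm_apply _
  refine ⟨D', LinearMap.ext fun x => of.injective ?_, LinearMap.ext fun x => of.injective ?_⟩
  · calc of (D' (u x)) = D ((X : R[X]) • of x) := by rw [hD', ← hof, aeval_X]
      _ = (C c - X : R[X]) • of (D' x) := by rw [map_smulₛₗ, substReflect_X, hD']
      _ = of ((algebraMap R _ c - u) (D' x)) := by rw [← hof, map_sub, aeval_C, aeval_X]
  · calc of (D' (D' x)) = (X * (C c - X) : R[X]) • of x := by rw [hD', hD', hD]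
      _ = of ((u * (algebraMap R _ c - u)) x) := by
        rw [← hof, map_mul, map_sub, aeval_C, aeval_X]

end HasReflection

theorem X_sub_C_pow_dvd_substReflect (α : R) (k : ℕ) :
    (X - C α) ^ k ∣ substReflect (2 * α) ((X - C α) ^ k) := by
  rw [map_pow, map_sub, substReflect_X, substReflect_C, two_mul, map_add, add_sub_right_comm,
    add_sub_cancel_right]
  exact pow_dvd_pow_of_dvd (dvd_sub_comm.1 dvd_rfl) k

theorem substReflect_comp_sq (α : R) (q : R[X]) :
    substReflect (2 * α) (q.comp ((X - C α) ^ 2)) = q.comp ((X - C α) ^ 2) := by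
  have h : C (2 * α) - X - C α = -(X - C α : R[X]) := by
    rw [two_mul, map_add]
    ring
  rw [substReflect, coe_compRingHom_apply, comp_assoc, pow_comp, sub_comp, X_comp, C_comp, h,
    neg_sq]

theorem HasReflection.quotient_comp_sq (α : R) (q : R[X]) :
    HasReflection (2 * α) (R[X] ⧸ Ideal.span {q.comp ((X - C α) ^ 2)}) := by
  have hg : X * substReflect (2 * α) X = X * (C (2 * α) - X) := by rw [substReflect_X]
  have hp : q.comp ((X - C α) ^ 2) ∣ X * substReflect (2 * α) (q.comp ((X - C α) ^ 2)) := by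
    rw [substReflect_comp_sq]
    exact dvd_mul_left _ _
  exact .quotient hg hp

variable {K : Type*} [Field K] {α : K}

theorem rootsPart_zero_self_two_mul (h2 : (2 : K) ≠ 0) (hα : α ≠ 0) (p : K[X]) :
    rootsPart {0, α, 2 * α} p = X ^ p.rootMultiplicity 0 *
      (X - C (2 * α)) ^ p.rootMultiplicity (2 * α) * (X - C α) ^ p.rootMultiplicity α := by
  classical
  have h0 : 0 ∉ ({α, 2 * α} : Finset K) := by
    simp [hα, hα.symm, h2]
  have h1 : α ∉ ({2 * α} : Finset K) := by
    simpa [two_mul] using hα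
  rw [rootsPart_eq_prod (Set.toFinite _) p]
  have : (Set.toFinite ({0, α, 2 * α} : Set K)).toFinset = {0, α, 2 * α} := by ext; simp
  rw [this, Finset.prod_insert h0, Finset.prod_insert h1, Finset.prod_singleton, C_0, sub_zero]
  ring

variable {E : Type*} [AddCommGroup E] [Module K E] {u : Module.End K E}

theorem IsElementaryFactors.rootMultiplicity_le_of_intertwined {n : ℕ} {P : Fin n → K[X]}
    (hP : IsElementaryFactors u P) {s t : K}
    (h : Intertwined (jordanCount u s) (jordanCount u t)) (i : Fin n) :
    (P i).rootMultiplicity s ≤ (P i).rootMultiplicity t + 1 ∧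
      (P i).rootMultiplicity t ≤ (P i).rootMultiplicity s + 1 := by
  have hcard (s) {k : ℕ} (hk : 1 ≤ k) := hP.jordanCount_eq_card s hk
  refine ⟨le_add_one_of_card_le (hP.monotone_rootMultiplicity s) (hP.monotone_rootMultiplicity t)
    (fun k hk => ?_) i, le_add_one_of_card_le (hP.monotone_rootMultiplicity t)
    (hP.monotone_rootMultiplicity s) (fun k hk => ?_) i⟩
  · have := (h k hk).2
    rwa [hcard s (by omega), hcard t hk, Nat.cast_le] at this
  · have := (h k hk).1
    rwa [hcard t (by omega), hcard s hk, Nat.cast_le] at this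

variable [FiniteDimensional K E]

theorem hasReflection_torsionBy_rootsPart (h2 : (2 : K) ≠ 0) (hα : α ≠ 0)
    (h : Intertwined (jordanCount u 0) (jordanCount u (2 * α))) :
    HasReflection (2 * α)
      (Submodule.torsionBy K[X] (Module.AEval' u) (rootsPart {0, α, 2 * α} (minpoly K u))) := by
  obtain ⟨n, P, hP⟩ := exists_elementaryFactors u
  obtain ⟨e⟩ := hP.nonempty_torsionBy_rootsPart_equiv {0, α, 2 * α}
  refine (HasReflection.pi fun i => ?_).congr e.symm
  obtain ⟨hle, hle'⟩ := hP.rootMultiplicity_le_of_intertwined h i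
  rw [rootsPart_zero_self_two_mul h2 hα]
  exact .quotient_pow_mul_pow_mul hle hle' (X_sub_C_pow_dvd_substReflect α _)

theorem IsElementaryFactors.hasReflection {F : Type*} [AddCommGroup F] [Module K F] {n : ℕ}
    {w : Module.End K F} {P : Fin n → K[X]} (hP : IsElementaryFactors w P)
    (h : ∀ i, ∃ Q : K[X], P i = Q.comp ((X - C α) ^ 2)) :
    HasReflection (2 * α) (Module.AEval' w) := by
  obtain ⟨-, -, ⟨e⟩⟩ := hP
  refine (HasReflection.pi fun i => ?_).congr e.symm
  obtain ⟨Q, hQ⟩ := h i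
  exact hQ ▸ .quotient_comp_sq α Q

end HasReflection

theorem theorem4 {K E : Type*} [Field K] [AddCommGroup E] [Module K E] [FiniteDimensional K E]
    (hK : ringChar K ≠ 2) (α : K) (hα : α ≠ 0) (u : Module.End K E) :
    IsComposite α α u ↔
      Intertwined (jordanCount u 0) (jordanCount u (2 * α)) ∧
      ∃ (N : ℕ) (P : Fin N → K[X]),
        IsElementaryFactors (awayPart {0, α, 2 * α} u) P ∧
        ∀ i, ∃ Q : K[X], P i = Q.comp ((X - C α) ^ 2) := by
  have h2 : (2 : K) ≠ 0 := Ring.two_ne_zero hK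
  have hc : 2 * α ≠ 0 := mul_ne_zero h2 hα
  rw [isComposite_iff_exists_isReflector hc]
  constructor
  · rintro ⟨D, hD⟩
    have hS : ∀ a ∈ ({0, α, 2 * α} : Set K), 2 * α - a ∈ ({0, α, 2 * α} : Set K) := by
      rintro a (rfl | rfl | rfl) <;> simp [two_mul]
    obtain ⟨s, hs, hsw⟩ := hD.exists_involution_awayPart hS (Set.mem_insert _ _)
    exact ⟨hD.intertwined hc, exists_elementaryFactors_of_semiconjBy h2 hs hsw
      (isUnit_awayPart_sub_algebraMap (by simp))⟩
  · rintro ⟨hI, N, P, hP, hPQ⟩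
    obtain ⟨e⟩ := nonempty_aeval'_equiv_torsionBy_prod {0, α, 2 * α} u
    exact ((hasReflection_torsionBy_rootsPart h2 hα hI).prod
      (hP.hasReflection hPQ)).congr e.symm |>.exists_isReflector
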